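/- Let $k$ be a field of characteristic zero, let $s \ge 2$, $t \ge 1$, $u \ge 0$ be integers, and let $c_1, c_2 \in k \setminus \{0\}$. Let $d$ denote the $k$-derivation $$d = \partial_x + x^u\,(c_1 x^t + c_2 y^s)\,\partial_y$$ of the polynomial ring $k[x,y]$. Then $d$ is simple, i.e. the only ideals $I$ of $k[x,y]$ with $d(I) \subseteq I$ are $\{0\}$ and $k[x,y]$. -/

import Mathlib

/-- An ideal `I` is `d`-differential if `d(I) ⊆ I`. -/
def Derivation.IsDifferentialIdeal {R A : Type*} [CommSemiring R] [CommRing A] [Algebra R A]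
    (d : Derivation R A A) (I : Ideal A) : Prop :=
  ∀ a ∈ I, d a ∈ I

/-- A derivation `d` of `A` is simple if `0` and `A` are the only `d`-differential ideals
of `A`. -/
def Derivation.IsSimple {R A : Type*} [CommSemiring R] [CommRing A] [Algebra R A]
    (d : Derivation R A A) : Prop :=
  ∀ I : Ideal A, d.IsDifferentialIdeal I → I = ⊥ ∨ I = ⊤

/-! ### Rational functions of one variable: poles and exact derivatives. -/

section Univariate

open Polynomial

variable {k : Type*} [Field k] [CharZero k]

/-! A nonzero proper differential ideal yields a Darboux polynomial `f ∣ d f` of positive degree in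
y (`exists_darboux`). The substitution x = T^s, y = v T^t turns s·x·d into T ∂_T + (s T^M h - t v)
∂_v with h = c₁ + c₂ v^s, and f into a curve F of T-degree N ≥ 1 whose cofactor L vanishes at T = 0.

Expand dF/F in powers of 1/T. If g is the leading coefficient of F and l the T^M-coefficient of L,
the top order gives s h g' = l g, so g divides a power of h. Closedness of dF/F at order T^(-M) then
makes (t v l - N s h)/h² the derivative of a rational function with poles only on h = 0
(`exists_integrability_at_infinity`). As h is squarefree, this function can be taken to be Q/h
(`exists_eq_mul_derivative_sub`), and the relation between extreme coefficients
(`coeff_relation_of_eq_mul_derivative_sub`) forces t·deg g = s N. But every monomial v^j T^n of F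
has t j ≤ n, so s N ≤ N, which is absurd for s ≥ 2. -/

/-- If `p ∣ h * p'` with `p ≠ 0` in characteristic zero, then `p` divides a power of `h`. -/
lemma Polynomial.dvd_pow_natDegree_of_dvd_mul_derivative {p h : k[X]} (hp : p ≠ 0)
    (hdvd : p ∣ h * derivative p) : p ∣ h ^ p.natDegree := by
  -- Each differentiation costs one factor h; after `p.natDegree` of them, p has become a nonzero
  -- constant.
  have key : ∀ r : ℕ, p ∣ h ^ r * derivative^[r] p := by
    intro r
    induction r with
    | zero => simp
    | succ r ih =>
      obtain ⟨q, hq⟩ := ih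
      have hd := congrArg derivative hq
      have e : h ^ (r + 1) * derivative^[r + 1] p
          = h * (derivative p * q + p * derivative q)
            - (r : k[X]) * derivative h * (p * q) := by
        rw [← derivative_mul, ← hd, ← hq, Function.iterate_succ_apply', derivative_mul,
          derivative_pow]
        rcases r with _ | r
        · simp
        · simp only [Nat.add_sub_cancel, map_natCast]
          ring
      rw [e]
      refine dvd_sub ?_ ⟨r * derivative h * q, by ring⟩
      rw [mul_add, ← mul_assoc]
      exact dvd_add (hdvd.mul_right q) (Dvd.intro (h * derivative q) (by ring))
  have hc := key p.natDegree
  have hconst : derivative^[p.natDegree] p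
      = C ((p.natDegree.factorial : k) * p.leadingCoeff) := by
    have hdeg : (derivative^[p.natDegree] p).natDegree = 0 := by
      have := natDegree_iterate_derivative p p.natDegree
      omega
    rw [eq_C_of_natDegree_eq_zero hdeg, coeff_iterate_derivative]
    simp [Nat.descFactorial_self]
  rw [hconst] at hc
  have hu : IsUnit (C ((p.natDegree.factorial : k) * p.leadingCoeff)) :=
    isUnit_C.2 (isUnit_iff_ne_zero.2 (mul_ne_zero
      (Nat.cast_ne_zero.2 (Nat.factorial_ne_zero _)) (leadingCoeff_ne_zero.2 hp)))
  exact (hu.dvd_mul_right).1 hc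

/-- If `P / h²` is the derivative of a fraction whose denominator is a power of `h`, where `h` is
coprime to `h'`, then it is the derivative of a fraction with denominator `h`. -/
lemma Polynomial.exists_eq_mul_derivative_sub {h : k[X]} (hh : IsCoprime h (derivative h))
    (h0 : h ≠ 0) {P : k[X]} (R : ℕ) {a : k[X]}
    (ha : h * derivative a - ((R : k[X]) + 1) * derivative h * a = P * h ^ R) :
    ∃ Q, h * derivative Q - derivative h * Q = P := by
  induction R generalizing a with
  | zero => exact ⟨a, by simpa using ha⟩
  | succ R ih =>
    -- The equation says (a/h^(R+1))' = P/h². Modulo h it shows that h divides a, so the pole order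
    -- drops.
    have hdvd : h ∣ derivative h * (C ((R : k) + 2) * a) := by
      refine ⟨derivative a - P * h ^ R, ?_⟩
      rw [pow_succ] at ha
      push_cast at ha
      simp only [map_add, map_natCast, map_ofNat]
      linear_combination -ha
    have hu : IsUnit (C ((R : k) + 2)) :=
      isUnit_C.2 (isUnit_iff_ne_zero.2 (by exact_mod_cast Nat.succ_ne_zero (R + 1)))
    obtain ⟨b, rfl⟩ := (hu.dvd_mul_left).1 (hh.dvd_of_dvd_mul_left hdvd)
    refine ih (a := b) (mul_left_cancel₀ h0 ?_)
    rw [derivative_mul] at ha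
    push_cast at ha
    linear_combination ha

/-- For `h = c₁ + c₂ X ^ s`, a numerator `P` of degree at most `s` of a fraction `P / h²` that is
the derivative of a rational function satisfies a linear relation between its extreme
coefficients. -/
lemma Polynomial.coeff_relation_of_eq_mul_derivative_sub {s : ℕ} (hs : 2 ≤ s) {c₁ c₂ : k}
    (hc₂ : c₂ ≠ 0) {P Q : k[X]} (hP : P.natDegree ≤ s)
    (hQ : (C c₁ + C c₂ * X ^ s) * derivative Q - derivative (C c₁ + C c₂ * X ^ s) * Q = P) :
    c₁ * P.coeff s = -(((s : k) - 1) * c₂ * P.coeff 0) := by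
  obtain ⟨m, rfl⟩ : ∃ m, s = m + 2 := ⟨s - 2, by omega⟩
  set h : k[X] := C c₁ + C c₂ * X ^ (m + 2) with hh
  have hdeg : h.natDegree = m + 2 := by
    rw [hh, add_comm, natDegree_add_C, natDegree_C_mul_X_pow _ _ hc₂]
  -- Since h' is a monomial of degree s - 1, X h'' = (s - 1) h'. Hence this operator cancels the Q
  -- and h'Q terms and leaves a multiple of h, constant by degree; its two extreme coefficients give
  -- the relation.
  set W : k[X] := X * derivative P - C ((m : k) + 1) * P with hW
  have hd : derivative h = C (c₂ * (m + 2)) * X ^ (m + 1) := by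
    simp only [hh, derivative_add, derivative_C, zero_add, derivative_C_mul, derivative_X_pow,
      C_mul, C_add, map_natCast, map_ofNat]
    push_cast
    ring
  set κ : k[X] := X * derivative (derivative Q) - C ((m : k) + 1) * derivative Q with hκ
  have hWh : W = h * κ := by
    rw [hW, hκ, ← hQ, derivative_sub, derivative_mul, derivative_mul, hd]
    simp only [derivative_mul, derivative_C, derivative_X_pow, map_add, map_mul, map_natCast,
      map_ofNat, map_one, Nat.add_sub_cancel, derivative_natCast, derivative_ofNat]
    push_cast
    ring
  have hWdeg : W.natDegree ≤ m + 2 := by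
    refine (natDegree_sub_le _ _).trans (max_le ?_ ((natDegree_C_mul_le _ _).trans hP))
    rcases Nat.eq_zero_or_pos P.natDegree with h0 | h0
    · rw [derivative_of_natDegree_zero h0]; simp
    · refine natDegree_mul_le.trans ?_
      have := natDegree_derivative_lt h0.ne'
      rw [natDegree_X]
      omega
  have hκdeg : κ.natDegree = 0 := by
    by_contra hne
    have hκ0 : κ ≠ 0 := by rintro e; simp [e] at hne
    have hh0 : h ≠ 0 := by rintro e; simp [e] at hdeg
    rw [hWh, natDegree_mul hh0 hκ0] at hWdeg
    omega
  obtain ⟨e, he⟩ : ∃ e, κ = C e := ⟨_, eq_C_of_natDegree_eq_zero hκdeg⟩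
  rw [he] at hWh
  have w0 := congrArg (coeff · 0) hWh
  have ws := congrArg (coeff · (m + 2)) hWh
  simp only [hW, hh, coeff_sub, coeff_mul_C, coeff_C_mul, coeff_add, coeff_X_pow, coeff_X_mul,
    coeff_C, coeff_derivative, mul_coeff_zero, coeff_X_zero] at w0 ws
  simp at w0 ws
  push_cast
  linear_combination c₁ * ws - c₂ * w0

end Univariate

/-! ### The two commuting derivations in T and v. -/

section Bivariate

open Polynomial

/-- The derivation of `k[X][X]` that differentiates the coefficients. -/
noncomputable def Polynomial.innerDerivative (k : Type*) [Field k] :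
    Derivation k k[X][X] k[X][X] :=
  PolynomialModule.equivPolynomialSelf.toLinearMap.compDer (derivative' (R := k)).mapCoeffs

/-- The Euler derivation `X * d/dX` of `k[X][X]` in the outer variable. -/
noncomputable def Polynomial.outerEuler (k : Type*) [Field k] :
    Derivation k k[X][X] k[X][X] :=
  (X : k[X][X]) • (derivative' (R := k[X])).restrictScalars k

variable {k : Type*} [Field k]

@[simp]
lemma Polynomial.coeff_innerDerivative (p : k[X][X]) (n : ℕ) :
    (innerDerivative k p).coeff n = derivative (p.coeff n) := rfl

lemma Polynomial.outerEuler_apply (p : k[X][X]) : outerEuler k p = X * derivative p := rfl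

@[simp]
lemma Polynomial.coeff_outerEuler (p : k[X][X]) (n : ℕ) :
    (outerEuler k p).coeff n = n * p.coeff n := by
  rw [outerEuler_apply]
  cases n with
  | zero => simp
  | succ n => rw [coeff_X_mul, coeff_derivative]; push_cast; ring

lemma Polynomial.innerDerivative_outerEuler (p : k[X][X]) :
    innerDerivative k (outerEuler k p) = outerEuler k (innerDerivative k p) := by
  ext1 n
  simp [derivative_mul]

lemma Polynomial.natDegree_innerDerivative_le (p : k[X][X]) :
    (innerDerivative k p).natDegree ≤ p.natDegree := by
  refine natDegree_le_iff_coeff_eq_zero.2 fun n hn => ?_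
  rw [coeff_innerDerivative, coeff_eq_zero_of_natDegree_lt hn, derivative_zero]

lemma Polynomial.natDegree_outerEuler_le (p : k[X][X]) :
    (outerEuler k p).natDegree ≤ p.natDegree := by
  refine natDegree_le_iff_coeff_eq_zero.2 fun n hn => ?_
  rw [coeff_outerEuler, coeff_eq_zero_of_natDegree_lt hn, mul_zero]

/-! ### Invariant curves near T = ∞. -/

/-- The logarithmic derivatives of `F` along two commuting derivations satisfy the integrability
condition; here they are written as fractions with denominator `F * G`. -/
lemma Derivation.log_integrability {R A : Type*} [CommRing R] [CommRing A] [Algebra R A]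
    (D E : Derivation R A A) (F G : A) (hDE : D (E F) = E (D F)) :
    F * G * E (D F * G) - D F * G * E (F * G) = F * G * D (E F * G) - E F * G * D (F * G) := by
  simp only [Derivation.leibniz, smul_eq_mul, hDE]
  ring

/-- An approximate inverse at infinity: if the leading coefficient of `F` divides `H`, then
`F` has a multiple that agrees with `H ^ (M + 1) * X ^ K` up to terms of degree less than
`K - M`. -/
lemma Polynomial.exists_mul_eq_C_mul_X_pow_add {R : Type*} [CommRing R] {F : R[X]} {H : R}
    (hF : F.leadingCoeff ∣ H) (hN : 1 ≤ F.natDegree) (M : ℕ) :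
    ∃ G E : R[X], F * G = C (H ^ (M + 1)) * X ^ (F.natDegree * (M + 1)) + E ∧
      E.natDegree + (M + 1) ≤ F.natDegree * (M + 1) := by
  obtain ⟨g, rfl⟩ := hF
  set N := F.natDegree with hNdef
  set a : R[X] := C (F.leadingCoeff * g) * X ^ N with ha
  have hb : (a - F * C g).natDegree ≤ N - 1 := by
    refine natDegree_le_iff_coeff_eq_zero.2 fun n hn => ?_
    rw [coeff_sub, coeff_mul_C, ha, coeff_C_mul, coeff_X_pow]
    split_ifs with h
    · rw [h, leadingCoeff, mul_one, ← hNdef, sub_self]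
    · rw [coeff_eq_zero_of_natDegree_lt (p := F) (by omega)]; simp
  -- With b = a - F g of lower degree than a, F g = a - b divides a^(M+1) - b^(M+1).
  obtain ⟨Q, hQ⟩ := sub_dvd_pow_sub_pow a (a - F * C g) (M + 1)
  refine ⟨C g * Q, -(a - F * C g) ^ (M + 1), ?_, ?_⟩
  · have : a ^ (M + 1) = C ((F.leadingCoeff * g) ^ (M + 1)) * X ^ (N * (M + 1)) := by
      rw [ha, mul_pow, ← C_pow, ← pow_mul]
    rw [← this]
    linear_combination -hQ
  · rw [natDegree_neg]
    have h1 := natDegree_pow_le_of_le (M + 1) hb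
    obtain ⟨N', hN'⟩ : ∃ N', N = N' + 1 := ⟨N - 1, by omega⟩
    rw [hN'] at h1 ⊢
    simp only [Nat.add_sub_cancel] at h1
    nlinarith

/-- The degree of the cofactor `L` of an invariant curve `F` of the vector field
`T ∂_T + (a T ^ M - b) ∂_v`, where `T` is the outer and `v` the inner variable. -/
lemma Polynomial.natDegree_cofactor_le {M : ℕ} {a b : k[X]} {F L : k[X][X]} (hF0 : F ≠ 0)
    (hF : outerEuler k F + (C a * X ^ M - C b) * innerDerivative k F = L * F) :
    L.natDegree ≤ M := by
  rcases eq_or_ne L 0 with rfl | hL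
  · simp
  have h1 : (L * F).natDegree ≤ M + F.natDegree := by
    rw [← hF]
    refine (natDegree_add_le _ _).trans
      (max_le ((natDegree_outerEuler_le F).trans (by omega)) ?_)
    refine natDegree_mul_le.trans (add_le_add ?_ (natDegree_innerDerivative_le F))
    refine (natDegree_sub_le _ _).trans (max_le (natDegree_C_mul_X_pow_le _ _) ?_)
    rw [natDegree_C]; omega
  rw [natDegree_mul hL hF0] at h1
  omega

/-- The equation satisfied by the leading coefficient of an invariant curve. -/
lemma Polynomial.mul_derivative_leadingCoeff {M : ℕ} (hM : 1 ≤ M) {a b : k[X]} {F L : k[X][X]}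
    (hF0 : F ≠ 0)
    (hF : outerEuler k F + (C a * X ^ M - C b) * innerDerivative k F = L * F) :
    a * derivative F.leadingCoeff = L.coeff M * F.leadingCoeff := by
  have hz : F.coeff (M + F.natDegree) = 0 := coeff_eq_zero_of_natDegree_lt (by omega)
  have := congrArg (coeff · (M + F.natDegree)) hF
  simp only [sub_mul, coeff_add, coeff_sub, coeff_outerEuler, mul_assoc, coeff_C_mul] at this
  rw [coeff_mul_add_eq_of_natDegree_le (natDegree_cofactor_le hF0 hF) le_rfl,
    add_comm M, coeff_X_pow_mul, add_comm _ M, coeff_innerDerivative, coeff_innerDerivative, hz,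
    mul_zero, derivative_zero, mul_zero, zero_add, sub_zero] at this
  exact this

/-- The integrability of the logarithmic derivative of an invariant curve `F` at infinity. -/
lemma Polynomial.exists_integrability_at_infinity {M : ℕ} (hM : 1 ≤ M) {a b : k[X]}
    {F L : k[X][X]} (hN : 1 ≤ F.natDegree) (hL0 : L.coeff 0 = 0)
    (hF : outerEuler k F + (C a * X ^ M - C b) * innerDerivative k F = L * F)
    {H₀ : k[X]} (hH₀ : H₀ ≠ 0) (hdvd : F.leadingCoeff ∣ H₀) :
    ∃ α : k[X], a ^ 2 * (H₀ ^ (M + 1) * derivative α - α * derivative (H₀ ^ (M + 1))) =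
      -(M * (b * L.coeff M - F.natDegree * a) * H₀ ^ (M + 1) * H₀ ^ (M + 1)) := by
  have hF0 : F ≠ 0 := by rintro rfl; simp at hN
  have hLdeg := natDegree_cofactor_le hF0 hF
  obtain ⟨G, E, hG, hE⟩ := exists_mul_eq_C_mul_X_pow_add hdvd hN M
  have hH0 : H₀ ^ (M + 1) ≠ 0 := pow_ne_zero _ hH₀
  generalize H₀ ^ (M + 1) = H at hG hH0 ⊢
  -- Now U = F G is H T^(M+J) plus terms of degree below J, so for i ≤ M the T^(-i)-coefficient of
  -- A/U or B/U is just a coefficient of A or B divided by H.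
  obtain ⟨J, hJ⟩ : ∃ J, F.natDegree * (M + 1) = M + J := ⟨F.natDegree * (M + 1) - M, by omega⟩
  rw [hJ] at hG hE
  have hEJ : E.natDegree < J := by omega
  have hG0 : G ≠ 0 := by
    rintro rfl
    have := congrArg (coeff · (M + J)) hG
    simp [coeff_eq_zero_of_natDegree_lt (show E.natDegree < M + J by omega)] at this
    exact hH0 this.symm
  have hU : (F * G).natDegree ≤ M + J := by
    rw [hG]
    exact (natDegree_add_le _ _).trans (max_le (natDegree_C_mul_X_pow_le _ _) (by omega))
  have hNG : F.natDegree + G.natDegree ≤ M + J := by rwa [natDegree_mul hF0 hG0] at hU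
  obtain ⟨g, hg⟩ : ∃ g, M + J = F.natDegree + g := ⟨M + J - F.natDegree, by omega⟩
  have hGg : G.natDegree ≤ g := by omega
  have htop : F.leadingCoeff * G.coeff g = H := by
    have := congrArg (coeff · (M + J)) hG
    simp only [coeff_add, coeff_C_mul, coeff_X_pow_self, mul_one,
      coeff_eq_zero_of_natDegree_lt (show E.natDegree < M + J by omega), add_zero] at this
    rwa [hg, coeff_mul_add_eq_of_natDegree_le le_rfl hGg] at this
  set A : k[X][X] := outerEuler k F * G with hA
  set B : k[X][X] := innerDerivative k F * G with hB
  have hAdeg : A.natDegree ≤ M + J := by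
    rw [hg]; exact natDegree_mul_le.trans (add_le_add (natDegree_outerEuler_le F) hGg)
  have hBdeg : B.natDegree ≤ M + J := by
    rw [hg]; exact natDegree_mul_le.trans (add_le_add (natDegree_innerDerivative_le F) hGg)
  have hAtop : A.coeff (M + J) = F.natDegree * H := by
    rw [hg, hA, coeff_mul_add_eq_of_natDegree_le (natDegree_outerEuler_le F) hGg,
      coeff_outerEuler, ← htop, leadingCoeff, mul_assoc]
  have hmul : A + (C a * (B * X ^ M) - C b * B) = C H * (L * X ^ (M + J)) + L * E := by
    rw [hA, hB]
    linear_combination G * hF + L * hG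
  have hLE : (L * E).natDegree < M + J :=
    natDegree_mul_le.trans_lt (by omega)
  -- `eq₁` and `eq₂` are the T^0 and T^M parts of the curve equation divided by U; `eq₃` is the
  -- T^(-M) part of integrability. Eliminating B leaves an equation for α = `A.coeff J`.
  have eq₁ : F.natDegree * H + (a * B.coeff J - b * B.coeff (M + J)) = 0 := by
    have := congrArg (coeff · (J + M)) hmul
    simp only [coeff_add, coeff_sub, coeff_C_mul, coeff_mul_X_pow] at this
    have hX : (L * X ^ (M + J)).coeff (M + J) = 0 := by
      simpa [hL0] using coeff_mul_X_pow L (M + J) 0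
    rw [add_comm J M, hAtop, coeff_eq_zero_of_natDegree_lt hLE, hX] at this
    simpa using this
  have eq₂ : a * B.coeff (M + J) = L.coeff M * H := by
    have := congrArg (coeff · (M + J + M)) hmul
    simp only [coeff_add, coeff_sub, coeff_C_mul, coeff_mul_X_pow] at this
    rw [add_comm (M + J) M, coeff_mul_X_pow,
      coeff_eq_zero_of_natDegree_lt (show A.natDegree < M + (M + J) by omega),
      coeff_eq_zero_of_natDegree_lt (show B.natDegree < M + (M + J) by omega),
      coeff_eq_zero_of_natDegree_lt (show (L * E).natDegree < M + (M + J) by omega)] at this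
    linear_combination this
  have hint := Derivation.log_integrability (innerDerivative k) (outerEuler k) F G
    (innerDerivative_outerEuler F)
  rw [← hA, ← hB, hG] at hint
  have hθU : outerEuler k (C H * X ^ (M + J) + E) =
      C ((M + J : ℕ) * H) * X ^ (M + J) + outerEuler k E := by
    ext1 n
    simp only [coeff_outerEuler, coeff_add, coeff_C_mul, coeff_X_pow, mul_add]
    split_ifs with h
    · rw [h]; ring
    · simp
  have hDU : innerDerivative k (C H * X ^ (M + J) + E) =
      C (derivative H) * X ^ (M + J) + innerDerivative k E := by
    ext1 n
    simp only [coeff_innerDerivative, coeff_add, coeff_C_mul, coeff_X_pow, derivative_add]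
    split_ifs with h <;> simp
  rw [hθU, hDU] at hint
  have hsmall : ∀ p q : k[X][X], p.natDegree ≤ E.natDegree → q.natDegree ≤ M + J →
      (p * q).coeff (J + (M + J)) = 0 := fun p q hp hq =>
    coeff_eq_zero_of_natDegree_lt (natDegree_mul_le.trans_lt (by omega))
  have hint' : C H * (outerEuler k B * X ^ (M + J)) + E * outerEuler k B
      - (C ((M + J : ℕ) * H) * (B * X ^ (M + J)) + outerEuler k E * B)
      = C H * (innerDerivative k A * X ^ (M + J)) + E * innerDerivative k A
      - (C (derivative H) * (A * X ^ (M + J)) + innerDerivative k E * A) := by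
    linear_combination hint
  have eq₃ := congrArg (coeff · (J + (M + J))) hint'
  simp only [coeff_add, coeff_sub, coeff_C_mul, coeff_mul_X_pow, coeff_outerEuler,
    coeff_innerDerivative] at eq₃
  rw [hsmall _ _ le_rfl ((natDegree_outerEuler_le B).trans hBdeg),
    hsmall _ _ le_rfl ((natDegree_innerDerivative_le A).trans hAdeg),
    hsmall _ _ (natDegree_outerEuler_le E) hBdeg,
    hsmall _ _ (natDegree_innerDerivative_le E) hAdeg] at eq₃
  refine ⟨A.coeff J, ?_⟩
  push_cast at eq₃
  linear_combination (-a ^ 2) * eq₃ - M * H * a * eq₁ - M * H * b * eq₂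

/-- If `h * f' = l * f` with `h` of degree `m + 1`, then `l` has degree at most `m` and its
coefficient of degree `m` is determined by the degree of `f`. -/
lemma Polynomial.natDegree_and_coeff_of_mul_derivative_eq {m : ℕ} {h f l : k[X]}
    (hdeg : h.natDegree = m + 1) (hf0 : f ≠ 0) (hlc : h * derivative f = l * f) :
    l.natDegree ≤ m ∧ l.coeff m = f.natDegree * h.leadingCoeff := by
  rcases Nat.eq_zero_or_pos f.natDegree with h0 | h0
  · rw [derivative_of_natDegree_zero h0, mul_zero, zero_eq_mul] at hlc
    simp [hlc.resolve_right hf0, h0]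
  obtain ⟨n, hn⟩ : ∃ n, f.natDegree = n + 1 := ⟨f.natDegree - 1, by omega⟩
  have hd : (derivative f).natDegree ≤ n := by
    have := natDegree_derivative_lt h0.ne'
    omega
  have hl : l.natDegree ≤ m := by
    rcases eq_or_ne l 0 with rfl | hl0
    · simp
    have h1 : (l * f).natDegree ≤ (m + 1) + n := by
      rw [← hlc]
      exact natDegree_mul_le.trans (add_le_add hdeg.le hd)
    rw [natDegree_mul hl0 hf0] at h1
    omega
  refine ⟨hl, ?_⟩
  have h1 := congrArg (coeff · ((m + 1) + n)) hlc
  rw [coeff_mul_add_eq_of_natDegree_le hdeg.le hd, show m + 1 + n = m + (n + 1) by ring,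
    coeff_mul_add_eq_of_natDegree_le hl hn.le, coeff_derivative, ← hdeg, ← hn,
    coeff_natDegree, coeff_natDegree] at h1
  refine mul_right_cancel₀ (leadingCoeff_ne_zero.2 hf0) ?_
  rw [← h1, ← Nat.cast_add_one, ← hn]
  ring

variable [CharZero k]

/-- Nonexistence of invariant curves at infinity for the vector field
`T ∂_T + (s T ^ M (c₁ + c₂ v ^ s) - t v) ∂_v`, where `T` is the outer and `v` the inner variable:
no `F` of positive degree in `T` has a cofactor `L` vanishing at `T = 0`. -/
lemma Polynomial.not_darboux_at_infinity {s t M : ℕ} (hs : 2 ≤ s) (hM : 1 ≤ M) {c₁ c₂ : k}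
    (hc₁ : c₁ ≠ 0) (hc₂ : c₂ ≠ 0) {F L : k[X][X]} (hN : 1 ≤ F.natDegree)
    (hlead : t * F.leadingCoeff.natDegree ≤ F.natDegree) (hL0 : L.coeff 0 = 0)
    (hF : outerEuler k F + (C ((s : k[X]) * (C c₁ + C c₂ * X ^ s)) * X ^ M - C ((t : k[X]) * X)) *
      innerDerivative k F = L * F) : False := by
  have hF0 : F ≠ 0 := by rintro rfl; simp at hN
  have hs0 : (s : k) ≠ 0 := Nat.cast_ne_zero.2 (by omega)
  have hM0 : (M : k) ≠ 0 := Nat.cast_ne_zero.2 (by omega)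
  set h : k[X] := C c₁ + C c₂ * X ^ s with hh
  have hdeg : h.natDegree = s := by
    rw [hh, add_comm, natDegree_add_C, natDegree_C_mul_X_pow _ _ hc₂]
  have hcs : h.coeff s = c₂ := by
    simp [hh, coeff_C, show s ≠ 0 by omega]
  have hc0 : h.coeff 0 = c₁ := by
    simp [hh, show 0 ≠ s by omega]
  have hh0 : h ≠ 0 := by rintro e; rw [e, natDegree_zero] at hdeg; omega
  have hcop : IsCoprime h (derivative h) := by
    obtain ⟨m, rfl⟩ : ∃ m, s = m + 1 := ⟨s - 1, by omega⟩
    -- Bézout from Euler's identity h - X h'/s = c₁.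
    refine ⟨C c₁⁻¹, -(C (c₁⁻¹ * ((m + 1 : ℕ) : k)⁻¹) * X), ?_⟩
    have e1 : (C c₁⁻¹ * C c₁ : k[X]) = 1 := by rw [← C_mul, inv_mul_cancel₀ hc₁, C_1]
    have e2 : (C ((m + 1 : ℕ) : k)⁻¹ * ((m + 1 : ℕ) : k[X])) = 1 := by
      rw [← C_eq_natCast, ← C_mul, inv_mul_cancel₀ hs0, C_1]
    simp only [hh, derivative_add, derivative_C, zero_add, derivative_C_mul, derivative_X_pow,
      Nat.add_sub_cancel, C_mul, map_natCast]
    linear_combination e1 - C c₁⁻¹ * C c₂ * X ^ (m + 1) * e2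
  clear_value h
  have hlc := mul_derivative_leadingCoeff hM hF0 hF
  set f : k[X] := F.leadingCoeff with hf
  have hf0 : f ≠ 0 := leadingCoeff_ne_zero.2 hF0
  set l : k[X] := L.coeff M with hl
  have hdeg' : ((s : k[X]) * h).natDegree = s := by
    rw [← C_eq_natCast, natDegree_C_mul hs0, hdeg]
  obtain ⟨m, hm⟩ : ∃ m, s = m + 1 := ⟨s - 1, by omega⟩
  obtain ⟨hldeg, hlcoeff⟩ := natDegree_and_coeff_of_mul_derivative_eq (hdeg'.trans hm) hf0 hlc
  have hlead' : ((s : k[X]) * h).leadingCoeff = s * c₂ := by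
    rw [leadingCoeff, hdeg', ← C_eq_natCast, coeff_C_mul, hcs]
  -- The extra factor h keeps the exponent positive when f is constant, so it can be written R + 1
  -- below.
  have hfh : f ∣ h ^ (f.natDegree + 1) := by
    refine (dvd_pow_natDegree_of_dvd_mul_derivative hf0 ?_).trans (pow_dvd_pow _ (Nat.le_succ _))
    have hu : IsUnit (s : k[X]) := by
      rw [← C_eq_natCast]; exact isUnit_C.2 (isUnit_iff_ne_zero.2 hs0)
    rw [← hu.dvd_mul_left, ← mul_assoc, hlc]
    exact Dvd.intro_left _ rfl
  obtain ⟨α, hα⟩ := exists_integrability_at_infinity hM hN hL0 hF (pow_ne_zero _ hh0) hfh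
  obtain ⟨R, hR⟩ : ∃ R, (f.natDegree + 1) * (M + 1) = R + 1 :=
    ⟨_, (Nat.succ_pred_eq_of_pos (by positivity)).symm⟩
  rw [← hl, ← pow_mul, hR, derivative_pow_succ] at hα
  set N := F.natDegree with hNdef
  set P : k[X] := C (-(M : k)) * ((t : k[X]) * X * l - (N : k[X]) * ((s : k[X]) * h)) with hP
  have hα' : h * derivative (C ((s : k) ^ 2) * α)
      - ((R : k[X]) + 1) * derivative h * (C ((s : k) ^ 2) * α) = P * h ^ R := by
    refine mul_left_cancel₀ (pow_ne_zero (R + 2) hh0) ?_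
    rw [derivative_C_mul, hP]
    simp only [C_pow, C_neg, map_natCast, C_add, C_1] at hα ⊢
    linear_combination hα
  obtain ⟨Q, hQ⟩ := exists_eq_mul_derivative_sub hcop hh0 R hα'
  have hPdeg : P.natDegree ≤ s := by
    refine (natDegree_C_mul_le _ _).trans ((natDegree_sub_le _ _).trans (max_le ?_ ?_))
    · rw [mul_assoc, ← C_eq_natCast]
      refine (natDegree_C_mul_le _ _).trans (natDegree_mul_le.trans ?_)
      rw [natDegree_X]; omega
    · rw [← C_eq_natCast]
      exact (natDegree_C_mul_le _ _).trans hdeg'.le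
  have hrel := coeff_relation_of_eq_mul_derivative_sub hs hc₂ hPdeg (by rw [← hh]; exact hQ)
  have hP0 : P.coeff 0 = M * N * s * c₁ := by
    rw [hP, coeff_C_mul, coeff_sub, mul_assoc, ← C_eq_natCast, ← C_eq_natCast, ← C_eq_natCast,
      coeff_C_mul, coeff_C_mul, coeff_C_mul, hc0]
    simp
    ring
  have hPs : P.coeff s = -M * (t * (f.natDegree * (s * c₂)) - N * (s * c₂)) := by
    rw [hP, coeff_C_mul, coeff_sub, mul_assoc, ← C_eq_natCast, ← C_eq_natCast, ← C_eq_natCast,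
      coeff_C_mul, coeff_C_mul, coeff_C_mul, hcs]
    conv_lhs => rw [hm, coeff_X_mul, hlcoeff, hlead', ← hm]
  rw [hP0, hPs] at hrel
  have hfin : ((t * f.natDegree : ℕ) : k) = ((s * N : ℕ) : k) := by
    have hne : (M : k) * s * c₁ * c₂ ≠ 0 := mul_ne_zero (mul_ne_zero (mul_ne_zero hM0 hs0) hc₁) hc₂
    refine mul_left_cancel₀ hne ?_
    push_cast
    linear_combination -hrel
  have hnat : t * f.natDegree = s * N := Nat.cast_injective hfin
  -- With `hlead` this gives s N ≤ N, against s ≥ 2 and N ≥ 1.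
  nlinarith

end Bivariate

/-! ### From differential ideals to Darboux polynomials. -/

section Darboux

open Polynomial

variable {k : Type*} [Field k]

lemma Polynomial.derivation_C_eq {d : Derivation k k[X][X] k[X][X]} (hd : d (C X) = 1) (p : k[X]) :
    d (C p) = C (derivative p) := by
  induction p using Polynomial.induction_on' with
  | add p q hp hq => simp [hp, hq]
  | monomial n a =>
    rw [← C_mul_X_pow_eq_monomial, C_mul, C_pow, Derivation.leibniz, Derivation.leibniz_pow, hd,
      show (C (C a) : k[X][X]) = algebraMap k _ a from rfl, Derivation.map_algebraMap]
    simp [derivative_X_pow]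

variable [CharZero k]

/-- A differential ideal for a derivation with `d x = 1` that contains a nonzero polynomial in `x`
is the unit ideal. -/
lemma Polynomial.eq_top_of_C_mem {d : Derivation k k[X][X] k[X][X]} (hd : d (C X) = 1)
    {I : Ideal k[X][X]} (hI : d.IsDifferentialIdeal I) {p : k[X]} (hp0 : p ≠ 0)
    (hp : C p ∈ I) : I = ⊤ := by
  induction hn : p.natDegree using Nat.strong_induction_on generalizing p with
  | _ n ih =>
    rcases Nat.eq_zero_or_pos n with h0 | h0
    · rw [eq_C_of_natDegree_eq_zero (hn.trans h0)] at hp hp0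
      refine I.eq_top_of_isUnit_mem hp (isUnit_C.2 (isUnit_C.2 (isUnit_iff_ne_zero.2 ?_)))
      exact fun e => hp0 (by rw [e, C_0])
    · have hne : p.natDegree ≠ 0 := by omega
      refine ih _ (hn ▸ natDegree_derivative_lt hne) (p := derivative p) (fun e => hne ?_)
        ?_ rfl
      · exact derivative_eq_zero.1 e
      · rw [← derivation_C_eq hd]; exact hI _ hp

/-- An element of minimal positive degree of an ideal divides every element of the ideal up to a
nonzero constant. -/
lemma Polynomial.exists_dvd_C_mul_of_minimal {R : Type*} [CommRing R] [IsDomain R]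
    {I : Ideal R[X]} {f : R[X]} (hf : f ∈ I) (hf0 : f ≠ 0)
    (hmin : ∀ g ∈ I, g ≠ 0 → f.natDegree ≤ g.natDegree) {g : R[X]} (hg : g ∈ I) :
    ∃ c : R, c ≠ 0 ∧ f ∣ C c * g := by
  induction hn : g.degree using WellFoundedLT.induction generalizing g with
  | _ n ih =>
    rcases eq_or_ne g 0 with rfl | hg0
    · exact ⟨1, one_ne_zero, by simp⟩
    have hle := hmin g hg hg0
    have hfl : f.leadingCoeff ≠ 0 := leadingCoeff_ne_zero.2 hf0
    have hgl : g.leadingCoeff ≠ 0 := leadingCoeff_ne_zero.2 hg0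
    have hlt : (C f.leadingCoeff * g
        - C g.leadingCoeff * X ^ (g.natDegree - f.natDegree) * f).degree < n := by
      rw [← hn, ← degree_C_mul (p := g) hfl]
      refine degree_sub_lt_left ?_ (mul_ne_zero (C_ne_zero.2 hfl) hg0) ?_
      · rw [degree_C_mul hfl, degree_mul, degree_C_mul_X_pow _ hgl,
          degree_eq_natDegree hf0, degree_eq_natDegree hg0]
        rw [← Nat.cast_add, Nat.sub_add_cancel hle]
      · rw [leadingCoeff_mul, leadingCoeff_mul, leadingCoeff_mul, leadingCoeff_X_pow, leadingCoeff_C,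
          leadingCoeff_C, mul_one, mul_comm]
    obtain ⟨c, hc, hdvd⟩ := ih _ hlt
      (I.sub_mem (I.mul_mem_left _ hg) (I.mul_mem_left _ hf)) rfl
    refine ⟨c * f.leadingCoeff, mul_ne_zero hc hfl, ?_⟩
    have := dvd_add hdvd (Dvd.intro_left
      (C c * (C g.leadingCoeff * X ^ (g.natDegree - f.natDegree))) rfl)
    convert this using 1
    rw [C_mul]
    ring

/-- A primitive polynomial that divides a nonzero constant multiple of `g` divides `g`. -/
lemma Polynomial.IsPrimitive.dvd_of_dvd_C_mul {R : Type*} [CommRing R] [IsDomain R]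
    [NormalizedGCDMonoid R] {f g : R[X]} (hf : f.IsPrimitive) {c : R} (hc : c ≠ 0)
    (hdvd : f ∣ C c * g) : f ∣ g := by
  rcases eq_or_ne g 0 with rfl | hg0
  · simp
  have h0 : C c * g ≠ 0 := mul_ne_zero (C_ne_zero.2 hc) hg0
  rw [← hf.dvd_primPart_iff_dvd h0, (associated_primPart_mul h0).dvd_iff_dvd_right,
    (isUnit_primPart_C c).dvd_mul_left, hf.dvd_primPart_iff_dvd hg0] at hdvd
  exact hdvd

/-- If a derivation `d` with `d x = 1` is not simple, then it has a Darboux polynomial of positive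
degree in `y`. -/
lemma Polynomial.exists_darboux {d : Derivation k k[X][X] k[X][X]} (hd : d (C X) = 1)
    {I : Ideal k[X][X]} (hI : d.IsDifferentialIdeal I) (hbot : I ≠ ⊥) (htop : I ≠ ⊤) :
    ∃ f : k[X][X], 1 ≤ f.natDegree ∧ f ∣ d f := by
  obtain ⟨f₀, hf₀, hf₀0⟩ := Submodule.exists_mem_ne_zero_of_ne_bot hbot
  obtain ⟨f, ⟨hf, hf0⟩, hmin⟩ := WellFounded.has_min (measure (natDegree (R := k[X]))).wf
    {f | f ∈ I ∧ f ≠ 0} ⟨f₀, hf₀, hf₀0⟩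
  have hmin' : ∀ g ∈ I, g ≠ 0 → f.natDegree ≤ g.natDegree :=
    fun g hg hg0 => not_lt.1 (hmin g ⟨hg, hg0⟩)
  have hpos : 1 ≤ f.natDegree := by
    by_contra hlt
    rw [eq_C_of_natDegree_eq_zero (show f.natDegree = 0 by omega)] at hf hf0
    exact htop (eq_top_of_C_mem hd hI (fun e => hf0 (by rw [e, C_0])) hf)
  obtain ⟨c, hc, hdvd⟩ := exists_dvd_C_mul_of_minimal hf hf0 hmin' (hI f hf)
  let _ : NormalizedGCDMonoid k[X] := Classical.choice inferInstance
  refine ⟨f.primPart, by rwa [natDegree_primPart], ?_⟩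
  have hcont : f.content ≠ 0 := fun e => hf0 (content_eq_zero_iff.1 e)
  refine f.isPrimitive_primPart.dvd_of_dvd_C_mul (mul_ne_zero hc hcont) ?_
  -- Leibniz on f = content · primitive part; the content lies in k[x] and its derivative only adds
  -- a multiple of the primitive part.
  have hdf : C (c * f.content) * d f.primPart =
      C c * d f - C c * C (derivative f.content) * f.primPart := by
    have h1 := congrArg d f.eq_C_content_mul_primPart
    rw [Derivation.leibniz, derivation_C_eq hd] at h1
    simp only [smul_eq_mul] at h1
    rw [h1, C_mul]
    ring
  rw [hdf]
  exact dvd_sub (f.primPart_dvd.trans hdvd) (Dvd.intro_left _ rfl)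

end Darboux

/-! ### The weighted substitution and the conclusion. -/

section Weighted

open Polynomial Polynomial.Bivariate

variable {k : Type*} [Field k]

/-- The substitution `x = T ^ s`, `y = v T ^ t`, where `T` is the outer and `v` the inner variable
of the target. -/
noncomputable def Polynomial.weightedSubst (k : Type*) [Field k] (s t : ℕ) :
    k[X][X] →ₐ[k] k[X][X] :=
  aevalAeval (X ^ s) (C X * X ^ t)

lemma Polynomial.weightedSubst_monomial (s t i j : ℕ) (a : k) :
    weightedSubst k s t (monomial j (monomial i a)) =
      monomial (s * i + t * j) (monomial j a) := by
  simp only [weightedSubst, ← C_mul_X_pow_eq_monomial]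
  simp [mul_pow]
  ring

lemma Polynomial.le_of_coeff_weightedSubst_ne_zero {s t n j : ℕ} {f : k[X][X]}
    (h : ((weightedSubst k s t f).coeff n).coeff j ≠ 0) : t * j ≤ n := by
  contrapose! h
  induction f using Polynomial.induction_on' with
  | add p q hp hq => simp [hp, hq]
  | monomial j' p =>
    induction p using Polynomial.induction_on' with
    | add p q hp hq => simp [hp, hq]
    | monomial i a =>
      rw [weightedSubst_monomial, coeff_monomial]
      split_ifs with h1
      · rw [coeff_monomial, if_neg]
        rintro rfl
        omega
      · simp

/-- The power of v remembers j, and then the power of T determines i, so no two monomials merge.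
This keeps the image of a Darboux polynomial nonconstant in T. -/
lemma Polynomial.coeff_weightedSubst {s : ℕ} (hs : 0 < s) (t i j : ℕ) (f : k[X][X]) :
    ((weightedSubst k s t f).coeff (s * i + t * j)).coeff j = (f.coeff j).coeff i := by
  induction f using Polynomial.induction_on' with
  | add p q hp hq => simp [hp, hq]
  | monomial j' p =>
    induction p using Polynomial.induction_on' with
    | add p q hp hq => simp [hp, hq]
    | monomial i' a =>
      rw [weightedSubst_monomial]
      simp only [coeff_monomial]
      by_cases hj : j' = j
      · subst hj
        by_cases hi : i' = i
        · simp [hi]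
        · simp [coeff_monomial, hi, hs.ne']
      · simp only [if_neg hj, coeff_zero]
        split_ifs <;> simp [coeff_monomial, hj]

/-- Both sides are derivations along the substitution, so agreement on constants, x and y suffices.
The value of M is the T-exponent that the y-component demands. -/
lemma Polynomial.weightedSubst_derivation {s t u M : ℕ} (hM : M + t = s * u + s * t + s)
    {c₁ c₂ : k} {d : Derivation k k[X][X] k[X][X]} (hdx : d (C X) = 1)
    (hdy : d X = C X ^ u * (C (C c₁) * C X ^ t + C (C c₂) * X ^ s)) (f : k[X][X]) :
    outerEuler k (weightedSubst k s t f) +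
      (C ((s : k[X]) * (C c₁ + C c₂ * X ^ s)) * X ^ M - C ((t : k[X]) * X)) *
        innerDerivative k (weightedSubst k s t f) =
      (s : k[X][X]) * X ^ s * weightedSubst k s t (d f) := by
  set φ := weightedSubst k s t with hφ
  set δ : Derivation k k[X][X] k[X][X] := outerEuler k +
    (C ((s : k[X]) * (C c₁ + C c₂ * X ^ s)) * X ^ M - C ((t : k[X]) * X) : k[X][X]) •
      innerDerivative k with hδ
  change δ (φ f) = _
  have hmul : ∀ p q, δ (φ p) = (s : k[X][X]) * X ^ s * φ (d p) →
      δ (φ q) = (s : k[X][X]) * X ^ s * φ (d q) →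
      δ (φ (p * q)) = (s : k[X][X]) * X ^ s * φ (d (p * q)) := by
    intro p q hp hq
    rw [map_mul, Derivation.leibniz, Derivation.leibniz, map_add, hp, hq]
    simp only [smul_eq_mul, map_mul]
    ring
  have hconst : ∀ a : k, δ (φ (C (C a))) = (s : k[X][X]) * X ^ s * φ (d (C (C a))) := by
    intro a
    rw [show (C (C a) : k[X][X]) = algebraMap k _ a from rfl, AlgHom.commutes,
      Derivation.map_algebraMap, Derivation.map_algebraMap, map_zero, mul_zero]
  have hinX : innerDerivative k (X : k[X][X]) = 0 := by
    ext1 n; rw [coeff_innerDerivative, coeff_X]; split_ifs <;> simp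
  have hinC : ∀ p : k[X], innerDerivative k (C p : k[X][X]) = C (derivative p) := by
    intro p
    ext1 n; rw [coeff_innerDerivative, coeff_C, coeff_C]; split_ifs <;> simp
  have hx : δ (φ (C X)) = (s : k[X][X]) * X ^ s * φ (d (C X)) := by
    have : φ (C X) = X ^ s := by simp [hφ, weightedSubst]
    rw [this, hdx, map_one, hδ]
    have h0 : innerDerivative k ((X : k[X][X]) ^ s) = 0 := by simp [Derivation.leibniz_pow, hinX]
    rw [Derivation.add_apply, Derivation.smul_apply, h0, smul_zero, add_zero]
    ext1 n
    simp only [coeff_outerEuler, mul_one, ← C_eq_natCast, coeff_C_mul, coeff_X_pow]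
    split_ifs with h <;> simp [h]
  have hy : δ (φ X) = (s : k[X][X]) * X ^ s * φ (d X) := by
    have h1 : φ X = C X * X ^ t := by simp [hφ, weightedSubst]
    have h2 : φ (C X) = X ^ s := by simp [hφ, weightedSubst]
    have h3 : ∀ a : k, φ (C (C a)) = C (C a) := by simp [hφ, weightedSubst]
    rw [hdy]
    have h4 : innerDerivative k (C X * X ^ t : k[X][X]) = X ^ t := by
      simp [Derivation.leibniz, Derivation.leibniz_pow, hinX, hinC]
    have h5 : outerEuler k (C X * X ^ t : k[X][X]) = (t : k[X][X]) * (C X * X ^ t) := by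
      ext1 n
      simp only [coeff_outerEuler, ← C_eq_natCast, coeff_C_mul, coeff_X_pow]
      split_ifs with h <;> simp [h]
    simp only [map_mul, map_add, map_pow, h1, h2, h3]
    rw [hδ, Derivation.add_apply, Derivation.smul_apply, h4, h5]
    have h6 : (X : k[X][X]) ^ M * X ^ t = (X ^ s) ^ u * X ^ s * (X ^ s) ^ t := by
      rw [← pow_add, hM, ← pow_mul, ← pow_mul]
      ring
    simp only [smul_eq_mul, C_mul, C_add, C_pow, map_natCast]
    rw [mul_pow, ← pow_mul X t s, mul_comm t s, pow_mul X s t]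
    linear_combination (s : k[X][X]) * (C (C c₁) + C (C c₂) * C X ^ s) * h6
  have hC : ∀ p : k[X], δ (φ (C p)) = (s : k[X][X]) * X ^ s * φ (d (C p)) := by
    intro p
    induction p using Polynomial.induction_on with
    | C a => exact hconst a
    | add p q hp hq => simp only [map_add, hp, hq, mul_add]
    | monomial n a ih =>
      rw [pow_succ, ← mul_assoc, C_mul]
      exact hmul _ _ ih hx
  induction f using Polynomial.induction_on with
  | C p => exact hC p
  | add p q hp hq => simp only [map_add, hp, hq, mul_add]
  | monomial n p ih =>
    rw [pow_succ, ← mul_assoc]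
    exact hmul _ _ ih hy

variable [CharZero k]

/-- The derivation of `k[x][y]` with `d x = 1` and `d y = x ^ u (c₁ x ^ t + c₂ y ^ s)` is simple. -/
theorem Polynomial.derivation_isSimple {s t u : ℕ} (hs : 2 ≤ s) (ht : 1 ≤ t) {c₁ c₂ : k}
    (hc₁ : c₁ ≠ 0) (hc₂ : c₂ ≠ 0) {d : Derivation k k[X][X] k[X][X]} (hdx : d (C X) = 1)
    (hdy : d X = C X ^ u * (C (C c₁) * C X ^ t + C (C c₂) * X ^ s)) : d.IsSimple := by
  intro I hI
  by_contra! hne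
  obtain ⟨f, hf, l, hl⟩ := exists_darboux hdx hI hne.1 hne.2
  obtain ⟨M, hM, hM1⟩ : ∃ M, M + t = s * u + s * t + s ∧ 1 ≤ M := by
    refine ⟨s * u + s * t + s - t, ?_, ?_⟩ <;>
    · have : t ≤ s * t := Nat.le_mul_of_pos_left t (by omega)
      omega
  have hφ := weightedSubst_derivation hM hdx hdy f
  rw [hl, mul_comm f l, map_mul (weightedSubst k s t), ← mul_assoc] at hφ
  have hf0 : f ≠ 0 := by rintro rfl; simp at hf
  have hcoef := coeff_weightedSubst (show 0 < s by omega) t f.leadingCoeff.natDegree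
    f.natDegree f
  have hne0 : (f.coeff f.natDegree).coeff f.leadingCoeff.natDegree ≠ 0 :=
    leadingCoeff_ne_zero.2 (leadingCoeff_ne_zero.2 hf0)
  rw [← hcoef] at hne0
  have hN : 1 ≤ (weightedSubst k s t f).natDegree := by
    have h1 : (weightedSubst k s t f).coeff
        (s * f.leadingCoeff.natDegree + t * f.natDegree) ≠ 0 := by
      intro e
      simp [e] at hne0
    have h2 := le_natDegree_of_ne_zero h1
    nlinarith
  have hF0 : weightedSubst k s t f ≠ 0 := by
    rintro e
    simp [e] at hN
  have hlead : t * (weightedSubst k s t f).leadingCoeff.natDegree ≤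
      (weightedSubst k s t f).natDegree := by
    have h1 : (weightedSubst k s t f).leadingCoeff ≠ 0 := leadingCoeff_ne_zero.2 hF0
    have h2 := leadingCoeff_ne_zero.2 h1
    rw [leadingCoeff] at h2
    exact le_of_coeff_weightedSubst_ne_zero h2
  have hL0 : ((s : k[X][X]) * X ^ s * weightedSubst k s t l).coeff 0 = 0 := by
    rw [mul_coeff_zero, mul_coeff_zero, coeff_X_pow, if_neg (by omega), mul_zero, zero_mul]
  exact not_darboux_at_infinity hs hM1 hc₁ hc₂ hN hlead hL0 hφ

end Weighted

/-! ### Transfer to `MvPolynomial (Fin 2) k`. -/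

open MvPolynomial in
theorem theorem4p4 {k : Type*} [Field k] [CharZero k] (s t u : ℕ) (hs : 2 ≤ s) (ht : 1 ≤ t)
    (c₁ c₂ : k) (hc₁ : c₁ ≠ 0) (hc₂ : c₂ ≠ 0) :
    (pderiv 0 +
      (X 0 ^ u * (C c₁ * X 0 ^ t + C c₂ * X 1 ^ s) : MvPolynomial (Fin 2) k) • pderiv 1 :
      Derivation k (MvPolynomial (Fin 2) k) (MvPolynomial (Fin 2) k)).IsSimple := by
  set D : Derivation k (MvPolynomial (Fin 2) k) (MvPolynomial (Fin 2) k) := pderiv 0 +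
      (X 0 ^ u * (C c₁ * X 0 ^ t + C c₂ * X 1 ^ s) : MvPolynomial (Fin 2) k) • pderiv 1 with hD
  let e := Polynomial.Bivariate.equivMvPolynomial k
  let d : Derivation k (Polynomial (Polynomial k)) (Polynomial (Polynomial k)) :=
    Derivation.mk' (e.symm.toLinearMap ∘ₗ D.toLinearMap ∘ₗ e.toLinearMap) fun p q => by
      simp [Derivation.leibniz]
  have hd : ∀ p, d p = e.symm (D (e p)) := fun p => rfl
  have hsimple : d.IsSimple := by
    refine Polynomial.derivation_isSimple (u := u) hs ht hc₁ hc₂ ?_ ?_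
    · rw [hd]
      simp [e, hD]
    · rw [hd]
      simp [e, hD]
  intro I hI
  have hcomap : d.IsDifferentialIdeal (I.comap e) := by
    intro a ha
    rw [Ideal.mem_comap, hd, AlgEquiv.apply_symm_apply]
    exact hI _ ha
  have hmap : (I.comap e).map e = I := Ideal.map_comap_of_surjective _ e.surjective I
  rcases hsimple _ hcomap with h | h
  · left; rw [← hmap, h, Ideal.map_bot]
  · right; rw [← hmap, h, Ideal.map_top]
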